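/- Let $n\ge 2$ and let $0<r\le \pi/2$. Let $M$ be a connected, complete Riemannian $n$-manifold and let $\varphi=(\varphi_1,\varphi_2):M\to\mathbb{S}^n\times\mathbb{R}$ be a smooth isometric immersion, where $\mathbb{S}^n$ is the unit sphere. Let $\alpha$ be its second fundamental form and let $|H|=\frac1n\|\operatorname{tr}\alpha\|$ be the absolute value of its mean curvature. Suppose that $\varphi_1(M)$ is contained in an open geodesic ball $B_{\mathbb{S}^n}(r)$ of radius $r$ and that $$\sup_M |H|\le \frac{(n-1)\cot(r)}{n}.$$ Then $M$ is non-parabolic, that is, there is a non-constant $C^2$ function on $M$ that is bounded above and subharmonic ($\Delta u\ge 0$). -/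

import Mathlib

open scoped Manifold ContDiff Bundle

noncomputable section

namespace Hypersurface

/-- The model space `ℝⁿ` with its Euclidean norm. -/
abbrev Eu (n : ℕ) : Type := EuclideanSpace ℝ (Fin n)

/-- The partial derivative `∂ᵢ f` of a map on `ℝⁿ`. -/
def pd {n : ℕ} {F : Type*} [NormedAddCommGroup F] [NormedSpace ℝ F]
    (i : Fin n) (f : Eu n → F) (y : Eu n) : F :=
  fderiv ℝ f y (EuclideanSpace.single i 1)

/-! ### The Laplacian of a Riemannian manifold and parabolicity -/

section Riemannian

variable {n : ℕ} {M : Type*} [TopologicalSpace M] [ChartedSpace (Eu n) M]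

/-- A map on `M` read in the preferred chart at `p`. -/
def inChart {F : Type*} (p : M) (u : M → F) (y : Eu n) : F :=
  u ((extChartAt (𝓡 n) p).symm y)

/-- The coordinate vector field `∂ᵢ` of the preferred chart at `p`, at the point of `M` with
coordinates `y`. -/
def coordVec (p : M) (i : Fin n) (y : Eu n) :
    TangentSpace (𝓡 n) ((extChartAt (𝓡 n) p).symm y) :=
  mfderiv 𝓘(ℝ, Eu n) (𝓡 n) (extChartAt (𝓡 n) p).symm y (EuclideanSpace.single i (1 : ℝ))

variable [Bundle.RiemannianBundle (fun x : M => TangentSpace (𝓡 n) x)]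

/-- The matrix `g_{ij}` of the Riemannian metric in the preferred chart at `p`. -/
def metricMatrix (p : M) (y : Eu n) : Matrix (Fin n) (Fin n) ℝ :=
  Matrix.of fun i j => inner ℝ (coordVec p i y) (coordVec p j y)

/-- The Christoffel symbol `Γᵏᵢⱼ` of the Levi-Civita connection in the preferred chart at `p`. -/
def christoffel (p : M) (i j k : Fin n) (y : Eu n) : ℝ :=
  (1 / 2) * ∑ l, (metricMatrix p y)⁻¹ k l *
    (pd i (fun z => metricMatrix p z j l) y + pd j (fun z => metricMatrix p z i l) y
      - pd l (fun z => metricMatrix p z i j) y)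

/-- The component `(Hess u)(∂ᵢ, ∂ⱼ)` of the Riemannian Hessian of `u` at the point `p`. -/
def hessian (u : M → ℝ) (p : M) (i j : Fin n) : ℝ :=
  pd i (pd j (inChart p u)) (extChartAt (𝓡 n) p p)
    - ∑ k, christoffel p i j k (extChartAt (𝓡 n) p p)
        * pd k (inChart p u) (extChartAt (𝓡 n) p p)

/-- The Laplace-Beltrami operator, the metric trace of the Hessian: `Δu = gⁱʲ (Hess u)ᵢⱼ`. -/
def laplacian (u : M → ℝ) (p : M) : ℝ :=
  ∑ i, ∑ j, (metricMatrix p (extChartAt (𝓡 n) p p))⁻¹ i j * hessian u p i j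

variable (n M) in
/-- A (connected) Riemannian manifold is parabolic if every `C²` subharmonic function on it that
is bounded above is constant. -/
def IsParabolic : Prop :=
  ∀ u : M → ℝ, ContMDiff (𝓡 n) 𝓘(ℝ, ℝ) 2 u → BddAbove (Set.range u) →
    (∀ p, 0 ≤ laplacian (n := n) u p) → ∃ c : ℝ, ∀ p, u p = c

end Riemannian

/-! ### Hypersurfaces of `𝕊ⁿ × ℝ` -/

/-- The unit sphere `𝕊ⁿ` in `ℝⁿ⁺¹`. -/
abbrev Sph (n : ℕ) : Type := Metric.sphere (0 : Eu (n + 1)) 1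

instance (n : ℕ) : Fact (Module.finrank ℝ (Eu (n + 1)) = n + 1) :=
  ⟨finrank_euclideanSpace_fin⟩

/-- The Euclidean space `ℝⁿ⁺¹ × ℝ`, with the product (Hilbert) inner product. -/
abbrev Amb (n : ℕ) : Type := WithLp 2 (Eu (n + 1) × ℝ)

/-- The inclusion `𝕊ⁿ × ℝ ⊆ ℝⁿ⁺¹ × ℝ`. The Riemannian product metric of `𝕊ⁿ × ℝ` is the one
induced by this inclusion. -/
def incl {n : ℕ} (q : Sph n × ℝ) : Amb n := WithLp.toLp 2 ((q.1 : Eu (n + 1)), q.2)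

/-- The open geodesic ball of radius `r` in `𝕊ⁿ` with centre `o`; the geodesic distance of `𝕊ⁿ` is
the angle between unit vectors. -/
def geodesicBall {n : ℕ} (o : Sph n) (r : ℝ) : Set (Sph n) :=
  {x | InnerProductGeometry.angle (x : Eu (n + 1)) (o : Eu (n + 1)) < r}

section Immersion

variable {n : ℕ} {M : Type*} [TopologicalSpace M] [ChartedSpace (Eu n) M]

/-- A smooth isometric immersion of the Riemannian manifold `M` into `𝕊ⁿ × ℝ`. -/
structure IsIsometricImmersion [Bundle.RiemannianBundle (fun x : M => TangentSpace (𝓡 n) x)]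
    (φ : M → Sph n × ℝ) : Prop where
  smooth : ContMDiff (𝓡 n) ((𝓡 n).prod 𝓘(ℝ, ℝ)) ∞ φ
  isometric : ∀ (p : M) (v w : TangentSpace (𝓡 n) p),
    inner ℝ (mvfderiv (𝓡 n) (fun x => incl (φ x)) p v) (mvfderiv (𝓡 n) (fun x => incl (φ x)) p w)
      = inner ℝ v w

/-- The normal space at `p` of the immersed hypersurface inside `𝕊ⁿ × ℝ`: the vectors that are
tangent to `𝕊ⁿ × ℝ` (orthogonal to the position vector of the `𝕊ⁿ`-component) and orthogonal to
the image of the differential of the immersion. -/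
def normalSpace (φ : M → Sph n × ℝ) (p : M) : Submodule ℝ (Amb n) :=
  (Submodule.span ℝ ({WithLp.toLp 2 (((φ p).1 : Eu (n + 1)), (0 : ℝ))} ∪
    Set.range (fun i : Fin n =>
      pd i (inChart p (fun x => incl (φ x))) (extChartAt (𝓡 n) p p))))ᗮ

/-- The second fundamental form `α(∂ᵢ, ∂ⱼ) = (∇̄_{∂ᵢ} ∂ⱼφ)^⊥` at `p`. The Levi-Civita connection of
`𝕊ⁿ × ℝ` is the tangential part of the Euclidean derivative, so this is the component of the
Euclidean second derivative in the normal space of the hypersurface in `𝕊ⁿ × ℝ`. -/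
def secondFundamentalForm (φ : M → Sph n × ℝ) (p : M) (i j : Fin n) : Amb n :=
  (normalSpace φ p).starProjection
    (pd i (pd j (inChart p (fun x => incl (φ x)))) (extChartAt (𝓡 n) p p))

variable [Bundle.RiemannianBundle (fun x : M => TangentSpace (𝓡 n) x)]

/-- The (unnormalized) mean curvature vector: the metric trace of the second fundamental form. -/
def meanCurvatureVector (φ : M → Sph n × ℝ) (p : M) : Amb n :=
  ∑ i, ∑ j, (metricMatrix p (extChartAt (𝓡 n) p p))⁻¹ i j • secondFundamentalForm φ p i j

/-- The absolute value `|H|` of the normalized mean curvature: `n |H| = ‖tr α‖`. -/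
def absMeanCurvature (φ : M → Sph n × ℝ) (p : M) : ℝ :=
  ‖meanCurvatureVector φ p‖ / n

end Immersion

end Hypersurface

end

noncomputable section

namespace Hypersurface

open Filter Topology

/-! ### Partial derivatives of maps from `ℝⁿ` into a Euclidean space -/

section Euclidean

variable {n : ℕ} {E E' : Type*} [NormedAddCommGroup E] [InnerProductSpace ℝ E]
  [NormedAddCommGroup E'] [NormedSpace ℝ E'] {F : Eu n → E} {y : Eu n}

/-! The witness is u = -⟨o, φ₁⟩ = -cos θ, where θ is the spherical distance to the centre o; it is
bounded by 1.

View M inside ℝⁿ⁺¹ × ℝ. The Hessian of a linear function is that function applied to the normal part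
of the Euclidean second derivative (`hessian_clm`). That part is α plus a multiple of the position
vector φ₁ (`secondFundamentalForm_eq`), so Δu = cos θ · tr⟨dφ₁, dφ₁⟩ - ⟨o, tr α⟩
(`laplacian_inner_fst`).

The trace is at least n - 1, since only the unit vertical direction is lost
(`sub_one_le_trace_fst`). As tr α ⊥ φ₁, only the part of o orthogonal to φ₁, of length sin θ, pairs
with it, so ⟨o, tr α⟩ ≤ (n-1) cot r sin θ. This is less than (n-1) cos θ because θ < r. Hence Δu > 0
everywhere, and u is not constant. -/

theorem contDiffAt_pd (hF : ContDiffAt ℝ 2 F y) (i : Fin n) : ContDiffAt ℝ 1 (pd i F) y :=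
  (hF.fderiv_right (m := 1) (by norm_num)).clm_apply contDiffAt_const

theorem differentiableAt_pd (hF : ContDiffAt ℝ 2 F y) (i : Fin n) :
    DifferentiableAt ℝ (pd i F) y :=
  (contDiffAt_pd hF i).differentiableAt one_ne_zero

theorem pd_congr {G : Eu n → E'} {H : Eu n → E'} (h : G =ᶠ[𝓝 y] H) (i : Fin n) :
    pd i G y = pd i H y := by
  rw [pd, pd, h.fderiv_eq]

theorem pd_pd_comm (hF : ContDiffAt ℝ 2 F y) (i j : Fin n) :
    pd i (pd j F) y = pd j (pd i F) y := by
  have hd : DifferentiableAt ℝ (fderiv ℝ F) y :=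
    (hF.fderiv_right (m := 1) (by norm_num)).differentiableAt one_ne_zero
  have key : ∀ a b : Fin n, pd a (pd b F) y
      = fderiv ℝ (fderiv ℝ F) y (EuclideanSpace.single a 1) (EuclideanSpace.single b 1) := by
    intro a b
    have := (hd.hasFDerivAt.clm_apply (hasFDerivAt_const (EuclideanSpace.single b (1 : ℝ)) y)).fderiv
    unfold pd
    rw [this]
    simp
  rw [key, key]
  exact hF.isSymmSndFDerivAt (by simp) _ _

theorem pd_inner {G H : Eu n → E} (hG : DifferentiableAt ℝ G y) (hH : DifferentiableAt ℝ H y)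
    (k : Fin n) :
    pd k (fun z => inner ℝ (G z) (H z)) y
      = inner ℝ (pd k G y) (H y) + inner ℝ (G y) (pd k H y) := by
  unfold pd
  rw [fderiv_inner_apply ℝ hG hH, add_comm]

theorem pd_clm (L : E →L[ℝ] E') (hF : DifferentiableAt ℝ F y) (i : Fin n) :
    pd i (fun z => L (F z)) y = L (pd i F y) := by
  unfold pd
  have := (L.hasFDerivAt.comp y hF.hasFDerivAt).fderiv
  change fderiv ℝ (L ∘ F) y _ = _
  rw [this]; rfl

theorem eventually_differentiableAt (hF : ContDiffAt ℝ 2 F y) :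
    ∀ᶠ z in 𝓝 y, DifferentiableAt ℝ F z :=
  (hF.eventually (by simp)).mono fun _ hz => hz.differentiableAt two_ne_zero

theorem pd_pd_clm (L : E →L[ℝ] E') (hF : ContDiffAt ℝ 2 F y) (i j : Fin n) :
    pd i (pd j fun z => L (F z)) y = L (pd i (pd j F) y) := by
  rw [← pd_clm L (differentiableAt_pd hF j)]
  exact pd_congr ((eventually_differentiableAt hF).mono fun z hz => pd_clm L hz j) i

/-- For a map into a unit sphere, the position component of the second derivative. -/
theorem inner_pd_pd_of_norm_one (hF : ContDiffAt ℝ 2 F y) (h1 : ∀ z, ‖F z‖ = 1) (i j : Fin n) :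
    inner ℝ (pd i (pd j F) y) (F y) = - inner ℝ (pd i F y) (pd j F y) := by
  have h0 : ∀ z, DifferentiableAt ℝ F z → inner ℝ (pd j F z) (F z) = 0 := by
    intro z hz
    have hc : (fun z => inner ℝ (F z) (F z)) = fun _ : Eu n => (1 : ℝ) := by
      funext z; simp [h1]
    have := pd_inner hz hz j
    rw [hc, real_inner_comm (pd j F z)] at this
    simp only [pd, fderiv_const_apply, zero_apply] at this ⊢
    linarith
  -- The orthogonality holds on a neighbourhood, so it may be differentiated once more.
  have h2 : pd i (fun z => inner ℝ (pd j F z) (F z)) y = 0 := by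
    rw [pd_congr ((eventually_differentiableAt hF).mono h0) i]
    simp [pd]
  rw [pd_inner (differentiableAt_pd hF j) (hF.differentiableAt two_ne_zero)] at h2
  rw [real_inner_comm (pd j F y)]
  linarith

theorem inner_pd_of_norm_one (hF : DifferentiableAt ℝ F y) (h1 : ∀ z, ‖F z‖ = 1) (j : Fin n) :
    inner ℝ (F y) (pd j F y) = 0 := by
  have hc : (fun z => inner ℝ (F z) (F z)) = fun _ : Eu n => (1 : ℝ) := by
    funext z; simp [h1]
  have := pd_inner hF hF j
  rw [hc, real_inner_comm (F y)] at this
  simp only [pd, fderiv_const_apply, zero_apply] at this ⊢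
  linarith

end Euclidean

/-! ### Gram matrices: tangential projection, Bessel inequality, trace -/

section Gram

variable {n : ℕ} {E : Type*} [NormedAddCommGroup E] [InnerProductSpace ℝ E]

/-- The component of `w` along the span of the vectors `v i`, in terms of their Gram matrix. -/
def tangentPart (v : Fin n → E) (w : E) : E :=
  ∑ k, (∑ l, (Matrix.gram ℝ v)⁻¹ k l * inner ℝ w (v l)) • v k

theorem inner_tangentPart {v : Fin n → E} (hv : LinearIndependent ℝ v) (w : E) (m : Fin n) :
    inner ℝ (tangentPart v w) (v m) = inner ℝ w (v m) := by
  have hdet : IsUnit (Matrix.gram ℝ v).det :=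
    (Matrix.posDef_gram_of_linearIndependent hv).det_pos.ne'.isUnit
  have hmul := Matrix.mul_nonsing_inv _ hdet
  have hsym : ∀ i j, inner ℝ (v i) (v j) = Matrix.gram ℝ v j i := fun i j => by
    rw [Matrix.gram_apply, real_inner_comm]
  calc inner ℝ (tangentPart v w) (v m)
      = ∑ k, ∑ l, (Matrix.gram ℝ v m k * (Matrix.gram ℝ v)⁻¹ k l) * inner ℝ w (v l) := by
        simp only [tangentPart, sum_inner, real_inner_smul_left, Finset.sum_mul, hsym]
        exact Finset.sum_congr rfl fun k _ => Finset.sum_congr rfl fun l _ => by ring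
    _ = ∑ l, (Matrix.gram ℝ v * (Matrix.gram ℝ v)⁻¹) m l * inner ℝ w (v l) := by
        rw [Finset.sum_comm]
        simp only [Matrix.mul_apply, Finset.sum_mul]
    _ = inner ℝ w (v m) := by
        rw [hmul]; simp [Matrix.one_apply]

theorem inner_sub_tangentPart {v : Fin n → E} (hv : LinearIndependent ℝ v) (w : E) (m : Fin n) :
    inner ℝ (w - tangentPart v w) (v m) = 0 := by
  rw [inner_sub_left, inner_tangentPart hv, sub_self]

theorem tangentPart_mem_span (v : Fin n → E) (w : E) :
    tangentPart v w ∈ Submodule.span ℝ (Set.range v) :=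
  Submodule.sum_mem _ fun k _ => Submodule.smul_mem _ _ (Submodule.subset_span ⟨k, rfl⟩)

/-- Bessel's inequality for the Gram matrix. -/
theorem sum_inv_gram_mul_inner_le {v : Fin n → E} (hv : LinearIndependent ℝ v) (w : E) :
    ∑ i, ∑ j, (Matrix.gram ℝ v)⁻¹ i j * (inner ℝ w (v i) * inner ℝ w (v j)) ≤ ‖w‖ ^ 2 := by
  set t := tangentPart v w with ht
  have hs : ∀ u : E, inner ℝ u t
      = ∑ i, ∑ j, (Matrix.gram ℝ v)⁻¹ i j * (inner ℝ u (v i) * inner ℝ w (v j)) := by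
    intro u
    simp only [ht, tangentPart, inner_sum, real_inner_smul_right, Finset.sum_mul]
    exact Finset.sum_congr rfl fun k _ => Finset.sum_congr rfl fun l _ => by ring
  -- t is the orthogonal projection of w, so ‖w - t‖² = ‖w‖² - ⟨w, t⟩, and ⟨w, t⟩ is the sum to be
  -- bounded.
  have htt : inner ℝ t t = inner ℝ w t := by
    rw [hs t, hs w]
    simp only [ht, inner_tangentPart hv]
  have h0 : 0 ≤ inner ℝ (w - t) (w - t) := real_inner_self_nonneg
  rw [inner_sub_left, inner_sub_right, inner_sub_right, htt, real_inner_comm w t,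
    real_inner_self_eq_norm_sq] at h0
  rw [← hs w]
  linarith

/-- Trace of G⁻¹G = 1, with G the Gram matrix. -/
theorem sum_inv_gram_mul_gram {v : Fin n → E} (hv : LinearIndependent ℝ v) :
    ∑ i, ∑ j, (Matrix.gram ℝ v)⁻¹ i j * inner ℝ (v i) (v j) = n := by
  have hdet : IsUnit (Matrix.gram ℝ v).det :=
    (Matrix.posDef_gram_of_linearIndependent hv).det_pos.ne'.isUnit
  have h := congrArg Matrix.trace (Matrix.nonsing_inv_mul _ hdet)
  simp only [Matrix.trace, Matrix.diag, Matrix.mul_apply, Matrix.one_apply_eq, Finset.sum_const,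
    Finset.card_univ, Fintype.card_fin, nsmul_eq_mul, mul_one] at h
  rw [← h]
  exact Finset.sum_congr rfl fun i _ => Finset.sum_congr rfl fun j _ => by
    rw [Matrix.gram_apply, real_inner_comm]

end Gram

/-! ### Coordinates, Christoffel symbols and Hessians for an induced metric -/

section Riemannian

variable {n : ℕ} {M : Type*} [TopologicalSpace M] [ChartedSpace (Eu n) M]
  {E : Type*} [NormedAddCommGroup E] [InnerProductSpace ℝ E]

theorem eventually_mem_extChartAt_target (p : M) :
    ∀ᶠ y in 𝓝 (extChartAt (𝓡 n) p p), y ∈ (extChartAt (𝓡 n) p).target :=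
  (isOpen_extChartAt_target p).mem_nhds (mem_extChartAt_target p)

theorem contDiffAt_inChart [IsManifold (𝓡 n) ∞ M] {ψ : M → E}
    (hψ : ContMDiff (𝓡 n) 𝓘(ℝ, E) ∞ ψ) {p : M} {y : Eu n}
    (hy : y ∈ (extChartAt (𝓡 n) p).target) : ContDiffAt ℝ ∞ (inChart p ψ) y := by
  rw [← contMDiffAt_iff_contDiffAt]
  exact hψ.contMDiffAt.comp y ((contMDiffOn_extChartAt_symm p).contMDiffAt
    ((isOpen_extChartAt_target p).mem_nhds hy))

theorem contDiffAt_inChart_self [IsManifold (𝓡 n) ∞ M] {ψ : M → E}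
    (hψ : ContMDiff (𝓡 n) 𝓘(ℝ, E) ∞ ψ) (p : M) :
    ContDiffAt ℝ 2 (inChart p ψ) (extChartAt (𝓡 n) p p) := by
  have h := contDiffAt_inChart hψ (mem_extChartAt_target (I := 𝓡 n) p)
  exact contDiffAt_infty.1 h 2

theorem mdifferentiableAt_preferredChart_symm [IsManifold (𝓡 n) ∞ M] {p : M} {y : Eu n}
    (hy : y ∈ (extChartAt (𝓡 n) p).target) :
    MDifferentiableAt 𝓘(ℝ, Eu n) (𝓡 n) (extChartAt (𝓡 n) p).symm y :=
  ((contMDiffOn_extChartAt_symm (n := ∞) p).contMDiffAt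
    ((isOpen_extChartAt_target p).mem_nhds hy)).mdifferentiableAt (by simp)

theorem mvfderiv_coordVec [IsManifold (𝓡 n) ∞ M] {ψ : M → E}
    (hψ : ContMDiff (𝓡 n) 𝓘(ℝ, E) ∞ ψ) {p : M} {y : Eu n}
    (hy : y ∈ (extChartAt (𝓡 n) p).target) (i : Fin n) :
    mvfderiv (𝓡 n) ψ ((extChartAt (𝓡 n) p).symm y) (coordVec p i y)
      = pd i (inChart p ψ) y := by
  have h := mfderiv_comp (I := 𝓘(ℝ, Eu n)) (I' := 𝓡 n) (I'' := 𝓘(ℝ, E)) y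
    (g := ψ) (f := (extChartAt (𝓡 n) p).symm)
    (hψ.contMDiffAt.mdifferentiableAt (by simp)) (mdifferentiableAt_preferredChart_symm hy)
  rw [mfderiv_eq_fderiv] at h
  exact (congrArg (fun T : Eu n →L[ℝ] E => T (EuclideanSpace.single i 1)) h).symm

theorem linearIndependent_coordVec [IsManifold (𝓡 n) ∞ M] (p : M) :
    LinearIndependent ℝ fun i => coordVec p i (extChartAt (𝓡 n) p p) := by
  have hinv := isInvertible_mfderivWithin_extChartAt_symm (I := 𝓡 n) (mem_extChartAt_target p)
  rw [ModelWithCorners.range_eq_univ, mfderivWithin_univ] at hinv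
  have h := (EuclideanSpace.basisFun (Fin n) ℝ).toBasis.linearIndependent.map'
    (mfderiv 𝓘(ℝ, Eu n) (𝓡 n) (extChartAt (𝓡 n) p).symm (extChartAt (𝓡 n) p p)).toLinearMap
    (LinearMap.ker_eq_bot.2 hinv.injective)
  convert! h using 2 with i
  rw [Function.comp_apply, OrthonormalBasis.coe_toBasis, EuclideanSpace.basisFun_apply]
  rfl

variable [Bundle.RiemannianBundle (fun x : M => TangentSpace (𝓡 n) x)]

theorem metricMatrix_eq_gram [IsManifold (𝓡 n) ∞ M] {ψ : M → E}
    (hψ : ContMDiff (𝓡 n) 𝓘(ℝ, E) ∞ ψ)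
    (hiso : ∀ (p : M) (v w : TangentSpace (𝓡 n) p),
      inner ℝ (mvfderiv (𝓡 n) ψ p v) (mvfderiv (𝓡 n) ψ p w) = inner ℝ v w)
    {p : M} {y : Eu n} (hy : y ∈ (extChartAt (𝓡 n) p).target) :
    metricMatrix p y = Matrix.gram ℝ fun i => pd i (inChart p ψ) y := by
  ext i j
  rw [metricMatrix, Matrix.of_apply, Matrix.gram_apply, ← mvfderiv_coordVec hψ hy,
    ← mvfderiv_coordVec hψ hy, hiso]

/-- An isometric differential is injective, so it carries the coordinate frame to independent
vectors. This makes the Gram matrix invertible. -/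
theorem linearIndependent_pd_inChart [IsManifold (𝓡 n) ∞ M] {ψ : M → E}
    (hψ : ContMDiff (𝓡 n) 𝓘(ℝ, E) ∞ ψ)
    (hiso : ∀ (p : M) (v w : TangentSpace (𝓡 n) p),
      inner ℝ (mvfderiv (𝓡 n) ψ p v) (mvfderiv (𝓡 n) ψ p w) = inner ℝ v w) (p : M) :
    LinearIndependent ℝ fun i => pd i (inChart p ψ) (extChartAt (𝓡 n) p p) := by
  have hy := mem_extChartAt_target (I := 𝓡 n) p
  simp_rw [← mvfderiv_coordVec hψ hy]
  refine (linearIndependent_coordVec p).map'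
    (mvfderiv (𝓡 n) ψ ((extChartAt (𝓡 n) p).symm (extChartAt (𝓡 n) p p))).toLinearMap ?_
  rw [LinearMap.ker_eq_bot']
  intro v hv
  have := hiso _ v v
  simp only [ContinuousLinearMap.coe_coe] at hv
  rw [hv, inner_zero_left] at this
  exact inner_self_eq_zero.mp this.symm

/-- The Koszul formula for a metric induced by an immersion into a Euclidean space. -/
theorem christoffel_eq {F : Eu n → E} {p : M} {y : Eu n} (hF : ContDiffAt ℝ 2 F y)
    (hg : ∀ᶠ z in 𝓝 y, metricMatrix p z = Matrix.gram ℝ fun i => pd i F z) (i j k : Fin n) :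
    christoffel p i j k y = ∑ l, (Matrix.gram ℝ fun i => pd i F y)⁻¹ k l *
      inner ℝ (pd i (pd j F) y) (pd l F y) := by
  have hd : ∀ a b c : Fin n, pd a (fun z => metricMatrix p z b c) y
      = inner ℝ (pd a (pd b F) y) (pd c F y) + inner ℝ (pd b F y) (pd a (pd c F) y) := by
    intro a b c
    rw [← pd_inner (differentiableAt_pd hF b) (differentiableAt_pd hF c)]
    exact pd_congr (hg.mono fun z hz => by rw [hz, Matrix.gram_apply]) a
  rw [christoffel, Finset.mul_sum]
  refine Finset.sum_congr rfl fun l _ => ?_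
  -- Symmetry of second derivatives collapses the Koszul combination to 2⟨∂ᵢ∂ⱼF, ∂ₗF⟩.
  rw [hd, hd, hd, hg.self_of_nhds, pd_pd_comm hF j i, pd_pd_comm hF l i, pd_pd_comm hF l j,
    real_inner_comm (pd j F y) (pd i (pd l F) y)]
  ring

/-- By `christoffel_eq`, the correction ∑ Γᵏᵢⱼ ∂ₖψ is exactly the tangential part of ∂ᵢ∂ⱼψ. -/
theorem hessian_clm [IsManifold (𝓡 n) ∞ M] {ψ : M → E}
    (hψ : ContMDiff (𝓡 n) 𝓘(ℝ, E) ∞ ψ)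
    (hiso : ∀ (p : M) (v w : TangentSpace (𝓡 n) p),
      inner ℝ (mvfderiv (𝓡 n) ψ p v) (mvfderiv (𝓡 n) ψ p w) = inner ℝ v w)
    (L : E →L[ℝ] ℝ) (p : M) (i j : Fin n) :
    hessian (fun q => L (ψ q)) p i j
      = L (pd i (pd j (inChart p ψ)) (extChartAt (𝓡 n) p p)
        - tangentPart (fun k => pd k (inChart p ψ) (extChartAt (𝓡 n) p p))
          (pd i (pd j (inChart p ψ)) (extChartAt (𝓡 n) p p))) := by
  have hF := contDiffAt_inChart_self hψ p
  have hg : ∀ᶠ z in 𝓝 (extChartAt (𝓡 n) p p),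
      metricMatrix p z = Matrix.gram ℝ fun i => pd i (inChart p ψ) z :=
    (eventually_mem_extChartAt_target p).mono fun z hz => metricMatrix_eq_gram hψ hiso hz
  have hc : inChart (n := n) p (fun q => L (ψ q)) = fun z => L (inChart (n := n) p ψ z) := rfl
  rw [hessian, hc, pd_pd_clm L hF, map_sub, tangentPart, map_sum]
  congr 1
  refine Finset.sum_congr rfl fun k _ => ?_
  rw [christoffel_eq hF hg, pd_clm L (hF.differentiableAt two_ne_zero), map_smul, smul_eq_mul]

end Riemannian

/-! ### Hypersurfaces of `𝕊ⁿ × ℝ` and the Laplacian of -cos θ -/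

section Immersion

variable {n : ℕ} {M : Type*} [TopologicalSpace M] [ChartedSpace (Eu n) M]

/-- The inclusion of `ℝⁿ⁺¹` as a factor of `ℝⁿ⁺¹ × ℝ`. -/
def horizontal {n : ℕ} (x : Eu (n + 1)) : Amb n := WithLp.toLp 2 (x, (0 : ℝ))

theorem inner_horizontal_left (x : Eu (n + 1)) (w : Amb n) :
    inner ℝ (horizontal x) w = inner ℝ x w.fst := by
  simp [horizontal, WithLp.prod_inner_apply]

theorem inner_horizontal (x y : Eu (n + 1)) :
    inner ℝ (horizontal x) (horizontal y) = inner ℝ x y := by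
  rw [inner_horizontal_left]; rfl

theorem norm_horizontal (x : Eu (n + 1)) : ‖horizontal x‖ = ‖x‖ := by
  rw [norm_eq_sqrt_real_inner, inner_horizontal, ← norm_eq_sqrt_real_inner]

theorem contMDiff_incl_comp {φ : M → Sph n × ℝ}
    (hφ : ContMDiff (𝓡 n) ((𝓡 n).prod 𝓘(ℝ, ℝ)) ∞ φ) :
    ContMDiff (𝓡 n) 𝓘(ℝ, Amb n) ∞ fun q => incl (φ q) := by
  have h1 : ContMDiff (𝓡 n) 𝓘(ℝ, Eu (n + 1)) ∞ fun q => ((φ q).1 : Eu (n + 1)) :=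
    contMDiff_coe_sphere.comp (contMDiff_fst.comp hφ)
  have h2 : ContMDiff (𝓡 n) 𝓘(ℝ, ℝ) ∞ fun q => (φ q).2 := contMDiff_snd.comp hφ
  exact (WithLp.prodContinuousLinearEquiv 2 ℝ (Eu (n + 1)) ℝ).symm.contDiff.comp_contMDiff
    (h1.prodMk_space h2)

theorem norm_fst_inChart_incl (φ : M → Sph n × ℝ) (p : M) (z : Eu n) :
    ‖WithLp.fstL 2 ℝ (Eu (n + 1)) ℝ (inChart p (fun x => incl (φ x)) z)‖ = 1 :=
  norm_eq_of_mem_sphere (φ ((extChartAt (𝓡 n) p).symm z)).1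

theorem inChart_self {F : Type*} (p : M) (u : M → F) :
    inChart p u (extChartAt (𝓡 n) p p) = u p := by
  rw [inChart, extChartAt_to_inv]

theorem inner_position_pd [IsManifold (𝓡 n) ∞ M] {φ : M → Sph n × ℝ}
    (hφ : ContMDiff (𝓡 n) ((𝓡 n).prod 𝓘(ℝ, ℝ)) ∞ φ) (p : M) (i : Fin n) :
    inner ℝ (horizontal (φ p).1)
      (pd i (inChart p fun x => incl (φ x)) (extChartAt (𝓡 n) p p)) = 0 := by
  have hF := contDiffAt_inChart_self (contMDiff_incl_comp hφ) p
  have hd := hF.differentiableAt two_ne_zero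
  have h := inner_pd_of_norm_one
    ((WithLp.fstL 2 ℝ (Eu (n + 1)) ℝ).differentiableAt.comp _ hd)
    (norm_fst_inChart_incl φ p) i
  simp only [Function.comp_def] at h
  rw [pd_clm _ hd, inChart_self] at h
  rw [inner_horizontal_left]
  exact h

theorem inner_position_pd_pd [IsManifold (𝓡 n) ∞ M] {φ : M → Sph n × ℝ}
    (hφ : ContMDiff (𝓡 n) ((𝓡 n).prod 𝓘(ℝ, ℝ)) ∞ φ) (p : M) (i j : Fin n) :
    inner ℝ (horizontal (φ p).1)
      (pd i (pd j (inChart p fun x => incl (φ x))) (extChartAt (𝓡 n) p p))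
      = - inner ℝ (pd i (inChart p fun x => incl (φ x)) (extChartAt (𝓡 n) p p)).fst
          (pd j (inChart p fun x => incl (φ x)) (extChartAt (𝓡 n) p p)).fst := by
  have hF := contDiffAt_inChart_self (contMDiff_incl_comp hφ) p
  have hd := hF.differentiableAt two_ne_zero
  have h := inner_pd_pd_of_norm_one
    ((WithLp.fstL 2 ℝ (Eu (n + 1)) ℝ).contDiff.comp_contDiffAt _ hF)
    (norm_fst_inChart_incl φ p) i j
  simp only [Function.comp_def] at h
  rw [pd_clm _ hd, pd_clm _ hd, pd_pd_clm _ hF, inChart_self, real_inner_comm] at h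
  rw [inner_horizontal_left]
  exact h

variable [Bundle.RiemannianBundle (fun x : M => TangentSpace (𝓡 n) x)]

/-- The Gauss formula: the second fundamental form in `𝕊ⁿ × ℝ` is obtained from the Euclidean
second derivative by removing its tangential part and its position component. -/
theorem secondFundamentalForm_eq [IsManifold (𝓡 n) ∞ M] {φ : M → Sph n × ℝ}
    (hφ : IsIsometricImmersion φ) (p : M) (i j : Fin n) :
    secondFundamentalForm φ p i j
      = pd i (pd j (inChart p fun x => incl (φ x))) (extChartAt (𝓡 n) p p)
        - tangentPart (fun k => pd k (inChart p fun x => incl (φ x)) (extChartAt (𝓡 n) p p))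
          (pd i (pd j (inChart p fun x => incl (φ x))) (extChartAt (𝓡 n) p p))
        - inner ℝ (horizontal (φ p).1)
          (pd i (pd j (inChart p fun x => incl (φ x))) (extChartAt (𝓡 n) p p))
          • horizontal (φ p).1 := by
  have hli := linearIndependent_pd_inChart (contMDiff_incl_comp hφ.smooth) hφ.isometric p
  have hXv := inner_position_pd hφ.smooth p
  rw [secondFundamentalForm]
  set v := fun k => pd k (inChart p fun x => incl (φ x)) (extChartAt (𝓡 n) p p) with hv
  set w := pd i (pd j (inChart p fun x => incl (φ x))) (extChartAt (𝓡 n) p p)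
  set X := horizontal (n := n) (φ p).1 with hX
  have hXX : inner ℝ X X = 1 := by
    rw [real_inner_self_eq_norm_sq, hX, norm_horizontal, norm_eq_of_mem_sphere, one_pow]
  have hXt : inner ℝ X (tangentPart v w) = 0 := by
    simp only [tangentPart, inner_sum, real_inner_smul_right]
    exact Finset.sum_eq_zero fun k _ => by rw [hXv k, mul_zero]
  -- The projection is characterised by two facts: the candidate is normal, and what was removed
  -- lies in the span of position and tangent vectors.
  refine Submodule.eq_starProjection_of_mem_orthogonal ?_ ?_
  · rw [normalSpace, Submodule.mem_orthogonal']
    intro u hu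
    induction hu using Submodule.span_induction with
    | mem u hu =>
      rcases hu with rfl | ⟨k, rfl⟩
      · change inner ℝ _ X = 0
        rw [real_inner_comm, inner_sub_right, inner_sub_right, real_inner_smul_right, hXt, hXX]
        ring
      · change inner ℝ _ (v k) = 0
        rw [inner_sub_left, inner_sub_tangentPart hli, real_inner_smul_left, hXv k]
        ring
    | zero => exact inner_zero_right _
    | add a b _ _ ha hb => rw [inner_add_right, ha, hb, add_zero]
    | smul c a _ ha => rw [real_inner_smul_right, ha, mul_zero]
  · apply Submodule.le_orthogonal_orthogonal
    rw [sub_sub, sub_sub_cancel]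
    refine Submodule.add_mem _ ?_ (Submodule.smul_mem _ _ (Submodule.subset_span (Or.inl rfl)))
    exact Submodule.span_mono Set.subset_union_right (tangentPart_mem_span v w)

theorem inner_position_meanCurvatureVector (φ : M → Sph n × ℝ) (p : M) :
    inner ℝ (horizontal (φ p).1) (meanCurvatureVector φ p) = 0 := by
  have hmem : meanCurvatureVector φ p ∈ normalSpace φ p :=
    Submodule.sum_mem _ fun i _ => Submodule.sum_mem _ fun j _ =>
      Submodule.smul_mem _ _ (Submodule.starProjection_apply_mem _ _)
  exact (Submodule.mem_orthogonal _ _).1 hmem _ (Submodule.subset_span (Or.inl rfl))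

/-- The Laplacian of the height of the spherical component in the direction `o`. -/
theorem laplacian_inner_fst [IsManifold (𝓡 n) ∞ M] {φ : M → Sph n × ℝ}
    (hφ : IsIsometricImmersion φ) (o : Sph n) (p : M) :
    laplacian (n := n) (fun q => - inner ℝ (o : Eu (n + 1)) ((φ q).1 : Eu (n + 1))) p
      = inner ℝ (o : Eu (n + 1)) ((φ p).1 : Eu (n + 1)) *
          ∑ i, ∑ j, (metricMatrix p (extChartAt (𝓡 n) p p))⁻¹ i j *
            inner ℝ (pd i (inChart p fun x => incl (φ x)) (extChartAt (𝓡 n) p p)).fst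
              (pd j (inChart p fun x => incl (φ x)) (extChartAt (𝓡 n) p p)).fst
        - inner ℝ (horizontal (o : Eu (n + 1))) (meanCurvatureVector φ p) := by
  have hu : (fun q => - inner ℝ (o : Eu (n + 1)) ((φ q).1 : Eu (n + 1)))
      = fun q => (-innerSL ℝ (horizontal (n := n) o)) (incl (φ q)) := by
    funext q
    rw [neg_apply, innerSL_apply_apply, inner_horizontal_left]
    rfl
  rw [hu, laplacian]
  simp only [meanCurvatureVector, inner_sum, real_inner_smul_right, Finset.mul_sum,
    ← Finset.sum_sub_distrib]
  refine Finset.sum_congr rfl fun i _ => Finset.sum_congr rfl fun j _ => ?_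
  -- Subtracting and re-adding the position component exposes α through the Gauss formula.
  rw [hessian_clm (contMDiff_incl_comp hφ.smooth) hφ.isometric,
    ← sub_add_cancel (_ - tangentPart _ _) (inner ℝ (horizontal (φ p).1)
          (pd i (pd j (inChart p fun x => incl (φ x))) (extChartAt (𝓡 n) p p))
          • horizontal (φ p).1), ← secondFundamentalForm_eq hφ,
    inner_position_pd_pd hφ.smooth]
  simp only [neg_apply, innerSL_apply_apply, inner_add_right, real_inner_smul_right,
    inner_horizontal]
  ring

/-- The full metric has trace n. The vertical contribution is the squared length of the tangential
part of the unit vector (0, 1), at most 1 by Bessel. -/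
theorem sub_one_le_trace_fst [IsManifold (𝓡 n) ∞ M] {φ : M → Sph n × ℝ}
    (hφ : IsIsometricImmersion φ) (p : M) :
    (n : ℝ) - 1 ≤ ∑ i, ∑ j, (metricMatrix p (extChartAt (𝓡 n) p p))⁻¹ i j *
      inner ℝ (pd i (inChart p fun x => incl (φ x)) (extChartAt (𝓡 n) p p)).fst
        (pd j (inChart p fun x => incl (φ x)) (extChartAt (𝓡 n) p p)).fst := by
  have hψ := contMDiff_incl_comp hφ.smooth
  have hli := linearIndependent_pd_inChart hψ hφ.isometric p
  rw [metricMatrix_eq_gram hψ hφ.isometric (mem_extChartAt_target p)]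
  set v := fun k => pd k (inChart p fun x => incl (φ x)) (extChartAt (𝓡 n) p p) with hv
  have hT := sum_inv_gram_mul_inner_le hli (WithLp.toLp 2 ((0 : Eu (n + 1)), (1 : ℝ)))
  have hn := sum_inv_gram_mul_gram hli
  have hTv : ∀ k, inner ℝ (WithLp.toLp 2 ((0 : Eu (n + 1)), (1 : ℝ))) (v k) = (v k).snd :=
    fun k => by simp
  have hTn : ‖(WithLp.toLp 2 ((0 : Eu (n + 1)), (1 : ℝ)) : Amb n)‖ ^ 2 = 1 := by
    rw [← real_inner_self_eq_norm_sq]; simp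
  have hsplit : ∀ i j, inner ℝ (v i).fst (v j).fst
      = inner ℝ (v i) (v j) - (v i).snd * (v j).snd := fun i j => by
    simp [WithLp.prod_inner_apply, mul_comm]
  change _ ≤ ∑ i, ∑ j, (Matrix.gram ℝ v)⁻¹ i j * inner ℝ (v i).fst (v j).fst
  simp only [hTv, hTn] at hT
  simp only [hsplit, mul_sub, Finset.sum_sub_distrib, hn]
  linarith

theorem laplacian_const (c : ℝ) (p : M) : laplacian (n := n) (fun _ => c) p = 0 := by
  have h : ∀ j : Fin n, pd j (inChart p fun _ : M => c) = fun _ => 0 := by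
    intro j; funext z
    have : inChart (n := n) p (fun _ : M => c) = fun _ => c := rfl
    simp [pd, this]
  simp only [laplacian, hessian, h]
  simp [pd]

/-- The negative of the cosine of the distance to the centre of the ball is strictly
subharmonic. -/
theorem laplacian_neg_inner_pos [IsManifold (𝓡 n) ∞ M] (hn : 2 ≤ n) {φ : M → Sph n × ℝ}
    (hφ : IsIsometricImmersion φ) {o : Sph n} {r : ℝ} (hr0 : 0 < r) (hr : r ≤ Real.pi / 2)
    {p : M} (hball : (φ p).1 ∈ geodesicBall o r)
    (hH : absMeanCurvature φ p ≤ ((n : ℝ) - 1) * Real.cot r / n) :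
    0 < laplacian (n := n) (fun q => - inner ℝ (o : Eu (n + 1)) ((φ q).1 : Eu (n + 1))) p := by
  have hn1 : (0 : ℝ) < (n : ℝ) - 1 := by
    have : (2 : ℝ) ≤ n := by exact_mod_cast hn
    linarith
  have hx : ‖((φ p).1 : Eu (n + 1))‖ = 1 := norm_eq_of_mem_sphere _
  have ho : ‖(o : Eu (n + 1))‖ = 1 := norm_eq_of_mem_sphere _
  set θ := InnerProductGeometry.angle ((φ p).1 : Eu (n + 1)) (o : Eu (n + 1)) with hθ
  have hθr : θ < r := hball
  have hθ0 : 0 ≤ θ := InnerProductGeometry.angle_nonneg _ _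
  have hcos : inner ℝ (o : Eu (n + 1)) ((φ p).1 : Eu (n + 1)) = Real.cos θ := by
    rw [real_inner_comm, InnerProductGeometry.inner_eq_cos_angle_of_norm_eq_one hx ho]
  have hpi := Real.pi_pos
  have hsinr : 0 < Real.sin r := Real.sin_pos_of_pos_of_lt_pi hr0 (by linarith)
  have hsinθ : 0 ≤ Real.sin θ := Real.sin_nonneg_of_nonneg_of_le_pi hθ0 (by linarith)
  -- The bound r ≤ π/2 makes the coefficient of the trace positive, so its lower bound can be used.
  have hcosθ : 0 < Real.cos θ := Real.cos_pos_of_mem_Ioo ⟨by linarith, by linarith⟩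
  have hnorm : ‖meanCurvatureVector φ p‖ ≤ ((n : ℝ) - 1) * Real.cot r :=
    (div_le_div_iff_of_pos_right (by linarith)).1 hH
  set m := meanCurvatureVector φ p with hm
  -- d is the part of o orthogonal to the position vector. Using it in Cauchy–Schwarz gives the
  -- factor sin θ instead of 1.
  set d := horizontal (n := n) (o : Eu (n + 1)) - Real.cos θ • horizontal ((φ p).1 : Eu (n + 1))
    with hd
  have hdn : ‖d‖ = Real.sin θ := by
    have hoo : inner ℝ (o : Eu (n + 1)) (o : Eu (n + 1)) = 1 := by simp
    have hxx : inner ℝ ((φ p).1 : Eu (n + 1)) ((φ p).1 : Eu (n + 1)) = 1 := by simp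
    rw [← Real.sqrt_sq hsinθ, ← Real.sqrt_sq (norm_nonneg d), ← real_inner_self_eq_norm_sq, hd]
    congr 1
    simp only [inner_sub_left, inner_sub_right, real_inner_smul_left, real_inner_smul_right,
      inner_horizontal, hoo, hxx, hcos,
      real_inner_comm (o : Eu (n + 1)) ((φ p).1 : Eu (n + 1))]
    rw [Real.sin_sq]
    ring
  have hmd : inner ℝ (horizontal (o : Eu (n + 1))) m = inner ℝ d m := by
    rw [hd, inner_sub_left, real_inner_smul_left, hm, inner_position_meanCurvatureVector]
    ring
  have hmle : inner ℝ (horizontal (o : Eu (n + 1))) m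
      ≤ ((n : ℝ) - 1) * Real.cot r * Real.sin θ := by
    rw [hmd]
    calc inner ℝ d m ≤ ‖d‖ * ‖m‖ := real_inner_le_norm _ _
      _ = ‖m‖ * Real.sin θ := by rw [hdn, mul_comm]
      _ ≤ _ := by gcongr
  -- Equivalent to sin(r - θ) > 0; the open ball makes the inequality strict.
  have hgap : Real.cot r * Real.sin θ < Real.cos θ := by
    have h := Real.sin_pos_of_pos_of_lt_pi (sub_pos.2 hθr) (by linarith)
    rw [Real.sin_sub] at h
    rw [Real.cot_eq_cos_div_sin, div_mul_eq_mul_div, div_lt_iff₀ hsinr]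
    linarith
  rw [laplacian_inner_fst hφ, hcos, sub_pos]
  calc _ ≤ ((n : ℝ) - 1) * Real.cot r * Real.sin θ := hmle
    _ = ((n : ℝ) - 1) * (Real.cot r * Real.sin θ) := mul_assoc _ _ _
    _ < ((n : ℝ) - 1) * Real.cos θ := by gcongr
    _ = Real.cos θ * ((n : ℝ) - 1) := mul_comm _ _
    _ ≤ _ := mul_le_mul_of_nonneg_left (sub_one_le_trace_fst hφ p) hcosθ.le

end Immersion

end Hypersurface

end

/-! ### Non-parabolicity -/

open Hypersurface in
theorem theorem4 (n : ℕ) (hn : 2 ≤ n)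
    {M : Type*} [MetricSpace M] [ConnectedSpace M] [CompleteSpace M]
    [ChartedSpace (EuclideanSpace ℝ (Fin n)) M] [IsManifold (𝓡 n) ∞ M]
    [Bundle.RiemannianBundle (fun x : M => TangentSpace (𝓡 n) x)]
    [IsContMDiffRiemannianBundle (𝓡 n) ∞ (EuclideanSpace ℝ (Fin n))
      (fun x : M => TangentSpace (𝓡 n) x)]
    [IsRiemannianManifold (𝓡 n) M]
    (φ : M → Sph n × ℝ) (hφ : IsIsometricImmersion φ)
    (o : Sph n) (r : ℝ) (hr0 : 0 < r) (hr : r ≤ Real.pi / 2)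
    (hball : ∀ p, (φ p).1 ∈ geodesicBall o r)
    (hH : ∀ p, absMeanCurvature φ p ≤ ((n : ℝ) - 1) * Real.cot r / n) :
    ¬ IsParabolic n M := by
  intro hpar
  have hpos := fun p => laplacian_neg_inner_pos hn hφ hr0 hr (hball p) (hH p)
  have hsmooth : ContMDiff (𝓡 n) 𝓘(ℝ, ℝ) 2
      fun q => - inner ℝ (o : Eu (n + 1)) ((φ q).1 : Eu (n + 1)) := by
    have h1 : ContMDiff (𝓡 n) 𝓘(ℝ, Eu (n + 1)) 2 fun q => ((φ q).1 : Eu (n + 1)) :=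
      contMDiff_coe_sphere.comp (contMDiff_fst.comp (contMDiff_infty.1 hφ.smooth 2))
    exact (-innerSL ℝ (o : Eu (n + 1))).contDiff.comp_contMDiff h1
  have hbdd : BddAbove (Set.range
      fun q => - inner ℝ (o : Eu (n + 1)) ((φ q).1 : Eu (n + 1))) := by
    refine ⟨1, ?_⟩
    rintro _ ⟨q, rfl⟩
    have h := abs_real_inner_le_norm (o : Eu (n + 1)) ((φ q).1 : Eu (n + 1))
    rw [norm_eq_of_mem_sphere, norm_eq_of_mem_sphere, one_mul] at h
    exact neg_le.1 (abs_le.1 h).1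
  obtain ⟨c, hc⟩ := hpar _ hsmooth hbdd fun p => (hpos p).le
  obtain ⟨p⟩ := (inferInstance : Nonempty M)
  have h := hpos p
  rw [funext hc, laplacian_const] at h
  exact h.false
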